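/- Let $r\ge 0$ and let $M\in\mathbb C^{2^r\times 2^r}$ be a Hermitian positive semidefinite matrix of full rank, with rows and columns indexed by $\{0,1\}^r$. For a sequence $T$ of $r$ distinct qubits in $[n]$ let $M_T=M|_T\otimes \mathrm{Id}_{[n]\setminus T}$ be the operator on $\mathbb C^{2^n}$ that applies $M$ to the qubits of $T$. An $M$-Hamiltonian on $n$ qubits is a set $\mathcal H$ of such sequences $T$. For $\varepsilon\in(0,1)$, an $\varepsilon$-sparsifier of $\mathcal H$ is a function $w:\mathcal H\to\mathbb R_{\ge 0}$ such that for every $\psi\in\mathbb C^{2^n}$ $$(1-\varepsilon)\sum_{T\in\mathcal H}\langle\psi,M_T\psi\rangle\ \le\ \sum_{T\in\mathcal H}w(T)\langle\psi,M_T\psi\rangle\ \le\ (1+\varepsilon)\sum_{T\in\mathcal H}\langle\psi,M_T\psi\rangle ;$$ its size is $|\mathrm{supp}(w)|$. (1) There is a constant $C>0$ depending only on $r$ and $M$ such that for all $n\ge1$, every $M$-Hamiltonian $\mathcal H$ on $n$ qubits and every $\varepsilon\in(0,1)$, $\mathcal H$ has an $\varepsilon$-sparsifier of size at most $C\varepsilon^{-2}n$.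 (2) There are constants $c_0,C>0$ depending only on $r$ and $M$ such that the following holds for every integer $k\ge1$, every real $c\ge c_0k$, all $n\ge1$, every $M$-Hamiltonian $\mathcal H$ on $n$ qubits and every $\varepsilon\in(0,1)$. Let $p=\min\{1,\,cn/(\varepsilon^2|\mathcal H|)\}$, let $\mathcal G\subseteq\mathcal H$ contain each $T\in\mathcal H$ independently with probability $p$, and put $w(T)=\mathbf 1(T\in\mathcal G)/p$. Then, with probability at least $1-n^{-k}$, $w$ is an $\varepsilon$-sparsifier of $\mathcal H$ of size at most $C\,c\,\varepsilon^{-2}n$. (If $\mathcal H=\emptyset$, the value of $p$ is irrelevant.) -/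

import Mathlib

open scoped NNReal Matrix ComplexOrder

/-- Bit strings of length `n`; they index the computational basis of `n` qubits. -/
abbrev BitString (n : ℕ) : Type := Fin n → Bool

/-- The operator `M_T = M|_T ⊗ Id` on `n` qubits, for a `2 ^ r × 2 ^ r` matrix `M` and a sequence
`T` of `r` distinct qubits: its `(x, y)` entry is `M (x|_T) (y|_T)` if `x` and `y` agree on all
qubits outside `T`, and `0` otherwise. -/
def localOperator {r n : ℕ} (M : Matrix (BitString r) (BitString r) ℂ) (T : Fin r ↪ Fin n) :
    Matrix (BitString n) (BitString n) ℂ :=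
  Matrix.of fun x y =>
    if ∀ i : Fin n, (∀ j : Fin r, T j ≠ i) → x i = y i then
      M (fun j => x (T j)) (fun j => y (T j))
    else 0

/-- The energy `⟨ψ, M_T ψ⟩` of a (not necessarily normalized) state `ψ`. It is a real number
whenever `M` is Hermitian, so that taking the real part loses nothing. -/
def termEnergy {r n : ℕ} (M : Matrix (BitString r) (BitString r) ℂ) (T : Fin r ↪ Fin n)
    (ψ : BitString n → ℂ) : ℝ :=
  (star ψ ⬝ᵥ (localOperator M T *ᵥ ψ)).re

/-- An `M`-Hamiltonian on `n` qubits, given by the set of all `r`-tuples of distinct qubits to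
which the predicate matrix `M` of arity `r` is applied. -/
abbrev PredicateHamiltonian (r n : ℕ) : Type := Finset (Fin r ↪ Fin n)

/-- The energy of the state `ψ` in the `M`-Hamiltonian `H`. -/
def energy {r n : ℕ} (M : Matrix (BitString r) (BitString r) ℂ) (H : PredicateHamiltonian r n)
    (ψ : BitString n → ℂ) : ℝ :=
  ∑ T : H, termEnergy M T.1 ψ

/-- The `w`-weighted energy of the state `ψ` in the `M`-Hamiltonian `H`. -/
def weightedEnergy {r n : ℕ} (M : Matrix (BitString r) (BitString r) ℂ)
    (H : PredicateHamiltonian r n) (w : H → ℝ≥0) (ψ : BitString n → ℂ) : ℝ :=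
  ∑ T : H, (w T : ℝ) * termEnergy M T.1 ψ

/-- The weight function `w` is an `ε`-sparsifier of the `M`-Hamiltonian `H`. -/
def IsSparsifier {r n : ℕ} (M : Matrix (BitString r) (BitString r) ℂ)
    (H : PredicateHamiltonian r n) (ε : ℝ) (w : H → ℝ≥0) : Prop :=
  ∀ ψ : BitString n → ℂ,
    (1 - ε) * energy M H ψ ≤ weightedEnergy M H w ψ ∧
      weightedEnergy M H w ψ ≤ (1 + ε) * energy M H ψ

/-- The size of a weight function: the cardinality of its support. -/
noncomputable def sparsifierSize {r n : ℕ} {H : PredicateHamiltonian r n} (w : H → ℝ≥0) : ℕ :=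
  (Function.support w).ncard

open Classical in
/-- The weights `w(T) = 1(T ∈ G) / p` attached to a set `G` of retained terms. -/
noncomputable def sampledWeight {r n : ℕ} (H : PredicateHamiltonian r n) (p : unitInterval)
    (G : Set (Fin r ↪ Fin n)) : H → ℝ≥0 :=
  fun T => if T.1 ∈ G then 1 / unitInterval.toNNReal p else 0

/-! Full rank gives `M ≥ l` for some `l > 0`, so every state has energy at least `l |H| ‖ψ‖²`
(`exists_le_termEnergy`). A relative error `ε` therefore only requires an additive error `ε l |H|
‖ψ‖²`, uniformly in `ψ`.

Uniformity in `ψ` comes from a reduction to scalars (`exists_scalar_energy_bound`). Write `M` as a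
combination of pure tensors whose factors come from a finite palette `S` of one-qubit Hermitian
matrices. Color each qubit by an element of `S`. For a fixed coloring and a fixed pure tensor, the
terms `T` on which the coloring matches the tensor are all diagonal in one product basis, so their
weighted sum is an average of scalar linear forms in the weights. Each `T` is matched by the same
fraction `|S|⁻ʳ` of colorings, so averaging over colorings recovers the original sum. Only
exponentially many forms in `n` arise, with bounded coefficients.

A Chernoff bound and a union bound over these forms (`setBernoulli_real_exists_abs_sum_gt_le`) then
show that a sample of expected size `c n / ε²` works once `c` exceeds a multiple of `k`. -/

/-! ### Tensor products of one-qubit matrices and product eigenbases. -/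

/-- The tensor product of one-qubit matrices. -/
def qubitTensor {n : ℕ} (B : Fin n → Matrix Bool Bool ℂ) :
    Matrix (BitString n) (BitString n) ℂ :=
  Matrix.of fun x y => ∏ i, B i (x i) (y i)

theorem qubitTensor_mul {n : ℕ} (B C : Fin n → Matrix Bool Bool ℂ) :
    qubitTensor B * qubitTensor C = qubitTensor fun i => B i * C i := by
  ext x y
  simp only [qubitTensor, Matrix.mul_apply, Matrix.of_apply, Finset.prod_univ_sum,
    Fintype.piFinset_univ, Finset.prod_mul_distrib]

theorem qubitTensor_diagonal {n : ℕ} (d : Fin n → Bool → ℂ) :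
    (qubitTensor fun i => Matrix.diagonal (d i)) =
      Matrix.diagonal fun x => ∏ i, d i (x i) := by
  ext x y
  by_cases h : x = y
  · subst h; simp [qubitTensor]
  · obtain ⟨i, hi⟩ := Function.ne_iff.1 h
    simp only [qubitTensor, Matrix.of_apply, Matrix.diagonal_apply_ne _ h]
    exact Finset.prod_eq_zero (Finset.mem_univ i) (Matrix.diagonal_apply_ne _ hi)

theorem qubitTensor_one {n : ℕ} :
    (qubitTensor fun _ : Fin n => (1 : Matrix Bool Bool ℂ)) = 1 := by
  simpa [← Matrix.diagonal_one] using qubitTensor_diagonal fun (_ : Fin n) (_ : Bool) => (1 : ℂ)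

theorem conjTranspose_qubitTensor {n : ℕ} (B : Fin n → Matrix Bool Bool ℂ) :
    (qubitTensor B)ᴴ = qubitTensor fun i => (B i)ᴴ := by
  ext x y
  simp [qubitTensor, Matrix.conjTranspose_apply]

theorem star_dotProduct_self_eq_sum {ι : Type*} [Fintype ι] (φ : ι → ℂ) :
    star φ ⬝ᵥ φ = ((∑ b, ‖φ b‖ ^ 2 : ℝ) : ℂ) := by
  simp [dotProduct, Complex.conj_mul']

theorem star_dotProduct_conj_mulVec {ι : Type*} [Fintype ι] (U A : Matrix ι ι ℂ) (ψ : ι → ℂ) :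
    star ψ ⬝ᵥ ((U * A * Uᴴ) *ᵥ ψ) = star (Uᴴ *ᵥ ψ) ⬝ᵥ (A *ᵥ (Uᴴ *ᵥ ψ)) := by
  rw [Matrix.star_mulVec, Matrix.conjTranspose_conjTranspose, ← Matrix.dotProduct_mulVec,
    Matrix.mulVec_mulVec, Matrix.mulVec_mulVec, Matrix.mul_assoc]

theorem sum_norm_sq_conjTranspose_mulVec {ι : Type*} [Fintype ι] [DecidableEq ι]
    {U : Matrix ι ι ℂ} (hU : U * Uᴴ = 1) (ψ : ι → ℂ) :
    ∑ b, ‖(Uᴴ *ᵥ ψ) b‖ ^ 2 = ∑ b, ‖ψ b‖ ^ 2 := by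
  have h := star_dotProduct_conj_mulVec U 1 ψ
  rw [Matrix.mul_one, hU, Matrix.one_mulVec, Matrix.one_mulVec, star_dotProduct_self_eq_sum,
    star_dotProduct_self_eq_sum] at h
  exact_mod_cast h.symm

/-- The pure tensor `⨂ j, A j`, localized at `T`, as a tensor product over all qubits. -/
theorem localOperator_qubitTensor {r n : ℕ} (A : Fin n → Matrix Bool Bool ℂ) (T : Fin r ↪ Fin n) :
    localOperator (qubitTensor fun j => A (T j)) T =
      qubitTensor fun i => if i ∈ Finset.univ.map T then A i else 1 := by
  ext x y
  have hsplit : ∏ i, (if i ∈ Finset.univ.map T then A i else 1) (x i) (y i) =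
      (∏ j, A (T j) (x (T j)) (y (T j))) *
        ∏ i with i ∉ Finset.univ.map T, (1 : Matrix Bool Bool ℂ) (x i) (y i) := by
    rw [← Finset.prod_filter_mul_prod_filter_not Finset.univ (· ∈ Finset.univ.map T)]
    congr 1
    · rw [Finset.filter_mem_eq_inter, Finset.univ_inter, Finset.prod_map]
      exact Finset.prod_congr rfl fun j _ => by simp
    · exact Finset.prod_congr rfl fun i hi => by rw [if_neg (Finset.mem_filter.1 hi).2]
  simp only [localOperator, qubitTensor, Matrix.of_apply] at hsplit ⊢
  rw [hsplit]
  split_ifs with h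
  · rw [Finset.prod_eq_one (s := Finset.univ.filter _), mul_one]
    intro i hi
    rw [h i (by simpa using hi), Matrix.one_apply_eq]
  · push Not at h
    obtain ⟨i, hi, hne⟩ := h
    have hzero : ∏ i with i ∉ Finset.univ.map T, (1 : Matrix Bool Bool ℂ) (x i) (y i) = 0 :=
      Finset.prod_eq_zero (i := i) (by simpa using hi) (Matrix.one_apply_ne hne)
    rw [hzero, mul_zero]

/-- If every `A i` is diagonalized by a unitary, so is the localized pure tensor. -/
theorem star_dotProduct_localOperator_qubitTensor {r n : ℕ} (U : Fin n → Matrix Bool Bool ℂ)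
    (d : Fin n → Bool → ℝ) (hU : ∀ i, U i * (U i)ᴴ = 1) (T : Fin r ↪ Fin n) (ψ : BitString n → ℂ) :
    star ψ ⬝ᵥ (localOperator (qubitTensor fun j =>
        U (T j) * Matrix.diagonal (fun b => (d (T j) b : ℂ)) * (U (T j))ᴴ) T *ᵥ ψ) =
      ((∑ b, ‖((qubitTensor U)ᴴ *ᵥ ψ) b‖ ^ 2 * ∏ j, d (T j) (b (T j)) : ℝ) : ℂ) := by
  rw [localOperator_qubitTensor
    (fun i => U i * Matrix.diagonal (fun b => (d i b : ℂ)) * (U i)ᴴ) T]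
  have hB : (fun i => if i ∈ Finset.univ.map T then
        U i * Matrix.diagonal (fun b => (d i b : ℂ)) * (U i)ᴴ else 1) =
      fun i => U i * Matrix.diagonal
        (fun b => if i ∈ Finset.univ.map T then (d i b : ℂ) else 1) * (U i)ᴴ := by
    funext i
    split_ifs
    · rfl
    · rw [Matrix.diagonal_one, Matrix.mul_one, hU]
  rw [hB, ← qubitTensor_mul, ← qubitTensor_mul, ← conjTranspose_qubitTensor,
    star_dotProduct_conj_mulVec, qubitTensor_diagonal]
  simp only [dotProduct, Matrix.mulVec_diagonal, Pi.star_apply, Complex.ofReal_sum]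
  refine Finset.sum_congr rfl fun b _ => ?_
  have hp : ∏ i, (if i ∈ Finset.univ.map T then (d i (b i) : ℂ) else 1) =
      ∏ j, (d (T j) (b (T j)) : ℂ) := by
    rw [Finset.prod_ite_mem, Finset.univ_inter, Finset.prod_map]
  rw [hp, mul_left_comm, ← starRingEnd_apply, Complex.conj_mul']
  push_cast
  ring

theorem sum_norm_sq_qubitTensor {n : ℕ} (U : Fin n → Matrix Bool Bool ℂ)
    (hU : ∀ i, U i * (U i)ᴴ = 1) (ψ : BitString n → ℂ) :
    ∑ b, ‖((qubitTensor U)ᴴ *ᵥ ψ) b‖ ^ 2 = ∑ b, ‖ψ b‖ ^ 2 := by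
  apply sum_norm_sq_conjTranspose_mulVec
  rw [conjTranspose_qubitTensor, qubitTensor_mul]
  simp only [hU, qubitTensor_one]

/-! ### Colorings and the reduction to scalar linear forms. -/

/-- Colorings extending a prescribed coloring of the sites of `T`. -/
theorem card_colorings_mul {S : Type*} [Fintype S] [DecidableEq S] {r n : ℕ} (T : Fin r ↪ Fin n)
    (s : Fin r → S) :
    (Finset.univ.filter fun χ : Fin n → S => ∀ j, χ (T j) = s j).card * Fintype.card S ^ r =
      Fintype.card S ^ n := by
  classical
  have hset : (Finset.univ.filter fun χ : Fin n → S => ∀ j, χ (T j) = s j) =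
      Fintype.piFinset fun i => if i ∈ Finset.univ.map T then
        Finset.univ.filter (fun c => ∀ j, T j = i → c = s j) else Finset.univ := by
    ext χ
    simp only [Finset.mem_filter, Finset.mem_univ, true_and, Fintype.mem_piFinset]
    constructor
    · intro h i
      split_ifs
      · simp only [Finset.mem_filter, Finset.mem_univ, true_and]
        rintro j rfl
        exact h j
      · exact Finset.mem_univ _
    · intro h j
      have := h (T j)
      rw [if_pos (by simp)] at this
      exact (Finset.mem_filter.1 this).2 j rfl
  have hpow : Fintype.card S ^ r =
      ∏ i, if i ∈ Finset.univ.map T then Fintype.card S else 1 := by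
    rw [Finset.prod_ite_mem, Finset.univ_inter, Finset.prod_const, Finset.card_map,
      Finset.card_univ, Fintype.card_fin]
  rw [hset, Fintype.card_piFinset, hpow, ← Finset.prod_mul_distrib]
  rw [Finset.prod_congr rfl (g := fun _ => Fintype.card S)]
  · simp
  · intro i _
    split_ifs with hi
    · obtain ⟨j, -, rfl⟩ := Finset.mem_map.1 hi
      have : (Finset.univ.filter fun c => ∀ k, T k = T j → c = s k) = {s j} := by
        ext c
        simp only [EmbeddingLike.apply_eq_iff_eq, forall_eq, Finset.mem_filter, Finset.mem_univ,
          true_and, Finset.mem_singleton]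
      rw [this]; simp
    · simp [Finset.card_univ]

/-- The one-qubit matrix units are combinations of finitely many unitarily diagonalized matrices
with real spectrum. -/
theorem exists_diagonalized_spanning : ∃ (S : Type) (_ : Fintype S) (_ : Nonempty S)
    (U : S → Matrix Bool Bool ℂ) (d : S → Bool → ℝ) (c : Bool → Bool → S → ℂ),
    (∀ s, U s * (U s)ᴴ = 1) ∧ ∀ a b, Matrix.single a b (1 : ℂ) =
      ∑ s, c a b s • (U s * Matrix.diagonal (fun i => (d s i : ℂ)) * (U s)ᴴ) := by
  -- The palette: real and imaginary Hermitian parts of each matrix unit, the last flag selecting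
  -- the imaginary part.
  let A : Bool × Bool × Bool → Matrix Bool Bool ℂ := fun s =>
    if s.2.2 then (imaginaryPart (Matrix.single s.1 s.2.1 (1 : ℂ)) : Matrix Bool Bool ℂ)
    else (realPart (Matrix.single s.1 s.2.1 (1 : ℂ)) : Matrix Bool Bool ℂ)
  have hA : ∀ s, (A s).IsHermitian := by
    intro s
    simp only [A]
    split_ifs
    · exact (imaginaryPart (Matrix.single s.1 s.2.1 (1 : ℂ))).2
    · exact (realPart (Matrix.single s.1 s.2.1 (1 : ℂ))).2
  have hspec : ∀ s, ((hA s).eigenvectorUnitary : Matrix Bool Bool ℂ) *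
      Matrix.diagonal (fun i => ((hA s).eigenvalues i : ℂ)) *
        ((hA s).eigenvectorUnitary : Matrix Bool Bool ℂ)ᴴ = A s := by
    intro s
    conv_rhs => rw [(hA s).spectral_theorem, Unitary.conjStarAlgAut_apply]
    rfl
  refine ⟨Bool × Bool × Bool, inferInstance, inferInstance,
    fun s => ((hA s).eigenvectorUnitary : Matrix Bool Bool ℂ), fun s => (hA s).eigenvalues,
    fun a b s => if s.1 = a ∧ s.2.1 = b then (if s.2.2 then Complex.I else 1) else 0, ?_, ?_⟩
  · intro s
    exact Unitary.coe_mul_star_self _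
  · intro a b
    simp only [hspec]
    conv_lhs => rw [← realPart_add_I_smul_imaginaryPart (Matrix.single a b (1 : ℂ))]
    simp only [Fintype.sum_prod_type, ite_and, ite_smul, zero_smul, Finset.sum_ite_eq',
      Finset.sum_ite_irrel, Finset.sum_const_zero, Finset.mem_univ, if_true]
    simp [A, add_comm]

/-- Each matrix unit on `r` qubits is a tensor product of one-qubit matrix units; expanding every
factor in the `A s` and distributing gives the coefficients. -/
theorem exists_qubitTensor_expansion {S : Type*} [Fintype S] (A : S → Matrix Bool Bool ℂ)
    (c : Bool → Bool → S → ℂ) (hc : ∀ a b, Matrix.single a b (1 : ℂ) = ∑ s, c a b s • A s)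
    {r : ℕ} (M : Matrix (BitString r) (BitString r) ℂ) :
    ∃ m : (Fin r → S) → ℂ, M = ∑ s, m s • qubitTensor fun j => A (s j) := by
  classical
  refine ⟨fun s => ∑ a, ∑ b, M a b * ∏ j, c (a j) (b j) (s j), ?_⟩
  ext x y
  have h1 : ∀ a b : BitString r, ∑ s : Fin r → S, ∏ j, (c (a j) (b j) (s j) * A (s j) (x j) (y j)) =
      if a = x ∧ b = y then 1 else 0 := by
    intro a b
    rw [← Fintype.piFinset_univ, ← Finset.prod_univ_sum (fun _ => Finset.univ)
      (fun j s => c (a j) (b j) s * A s (x j) (y j))]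
    have : ∀ j, ∑ s, c (a j) (b j) s * A s (x j) (y j) =
        Matrix.single (a j) (b j) (1 : ℂ) (x j) (y j) := by
      intro j
      rw [hc]; simp [Matrix.sum_apply]
    simp only [this, Matrix.single_apply]
    split_ifs with h
    · obtain ⟨rfl, rfl⟩ := h; simp
    · rw [not_and_or] at h
      rcases h with h | h
      all_goals
        obtain ⟨i, hi⟩ := Function.ne_iff.1 h
        exact Finset.prod_eq_zero (Finset.mem_univ i) (by simp [hi])
  simp only [Matrix.sum_apply, Matrix.smul_apply, qubitTensor, Matrix.of_apply, smul_eq_mul,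
    Finset.sum_mul, mul_assoc, ← Finset.prod_mul_distrib]
  rw [Finset.sum_comm]
  simp_rw [Finset.sum_comm (s := (Finset.univ : Finset (Fin r → S))), ← Finset.mul_sum, h1]
  simp [ite_and]

theorem localOperator_sum_smul {κ : Type*} {r n : ℕ} (s : Finset κ) (m : κ → ℂ)
    (A : κ → Matrix (BitString r) (BitString r) ℂ) (T : Fin r ↪ Fin n) :
    localOperator (∑ k ∈ s, m k • A k) T = ∑ k ∈ s, m k • localOperator (A k) T := by
  ext x y
  simp only [localOperator, Matrix.of_apply, Matrix.sum_apply, Matrix.smul_apply]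
  split_ifs <;> simp

/-- Linear combinations of the energies of local terms are controlled by exponentially many scalar
linear forms, uniformly in the state. -/
theorem exists_scalar_energy_bound (r : ℕ) (M : Matrix (BitString r) (BitString r) ℂ) :
    ∃ (K : ℝ) (q Q : ℕ), 0 < K ∧ ∀ n : ℕ, ∃ (J : Type) (_ : Fintype J)
      (g : J → (Fin r ↪ Fin n) → ℝ), Fintype.card J ≤ q * Q ^ n ∧ (∀ j T, |g j T| ≤ K) ∧
      ∀ (H : PredicateHamiltonian r n) (x : (Fin r ↪ Fin n) → ℝ) (δ : ℝ), 0 ≤ δ →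
        (∀ j, |∑ T ∈ H, x T * g j T| ≤ δ) → ∀ ψ : BitString n → ℂ,
          |∑ T ∈ H, x T * termEnergy M T ψ| ≤ K * δ * ∑ b, ‖ψ b‖ ^ 2 := by
  classical
  obtain ⟨S, _, _, U, d, c, hU, hc⟩ := exists_diagonalized_spanning
  obtain ⟨m, hm⟩ := exists_qubitTensor_expansion _ c hc M
  obtain ⟨D, hD1, hD⟩ : ∃ D : ℝ, 1 ≤ D ∧ ∀ s b, |d s b| ≤ D := by
    refine ⟨1 + ∑ s, ∑ b, |d s b|, ?_, fun s b => ?_⟩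
    · have : 0 ≤ ∑ s, ∑ b, |d s b| := by positivity
      linarith
    · have h1 := Finset.single_le_sum (f := fun b => |d s b|) (fun _ _ => abs_nonneg _)
        (Finset.mem_univ b)
      have h2 := Finset.single_le_sum (f := fun s => ∑ b, |d s b|)
        (fun _ _ => Finset.sum_nonneg fun _ _ => abs_nonneg _) (Finset.mem_univ s)
      linarith
  set N : ℝ := (Fintype.card S : ℝ) with hN
  have hNpos : 0 < N := by rw [hN]; exact_mod_cast Fintype.card_pos
  -- One constant for two purposes: `D ^ r` bounds the coefficients of the forms, and `N ^ r * ∑ ‖m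
  -- s‖` is the loss from averaging over colorings and summing the expansion.
  set K : ℝ := D ^ r + N ^ r * ∑ s, ‖m s‖ with hK
  have hD0 : 0 < D := by linarith
  have hsum0 : 0 ≤ ∑ s, ‖m s‖ := Finset.sum_nonneg fun _ _ => norm_nonneg _
  have hDr : 0 < D ^ r := by positivity
  have hNr : 0 < N ^ r := by positivity
  have hKD : D ^ r ≤ K := by
    rw [hK]; have := mul_nonneg hNr.le hsum0; linarith
  have hKN : N ^ r * ∑ s, ‖m s‖ ≤ K := by rw [hK]; linarith
  refine ⟨K, Fintype.card S ^ r, 2 * Fintype.card S, by linarith, fun n => ?_⟩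
  -- A form is indexed by a coloring, a pattern of factors, and a vector of the product basis; its
  -- coefficient at a matching `T` is the eigenvalue of that term.
  refine ⟨(Fin n → S) × (Fin r → S) × (Fin n → Bool), inferInstance,
    fun j T => if ∀ i, j.1 (T i) = j.2.1 i then ∏ i, d (j.1 (T i)) (j.2.2 (T i)) else 0,
    ?_, ?_, ?_⟩
  · simp only [Fintype.card_prod, Fintype.card_fun, Fintype.card_fin, Fintype.card_bool, mul_pow]
    apply le_of_eq; ring
  · rintro ⟨χ, s, b⟩ T
    dsimp only
    split_ifs
    · rw [Finset.abs_prod]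
      calc _ ≤ ∏ _i : Fin r, D := Finset.prod_le_prod (fun _ _ => abs_nonneg _) fun _ _ => hD _ _
        _ ≤ K := by simpa using hKD
    · rw [abs_zero]; linarith
  intro H x δ hδ hx ψ
  set P : (Fin r → S) → (Fin r ↪ Fin n) → ℂ := fun s T =>
    star ψ ⬝ᵥ (localOperator (qubitTensor fun j =>
      U (s j) * Matrix.diagonal (fun b => (d (s j) b : ℂ)) * (U (s j))ᴴ) T *ᵥ ψ) with hP
  have hterm : ∀ T, termEnergy M T ψ = (∑ s, m s * P s T).re := by
    intro T
    rw [termEnergy, hm, localOperator_sum_smul]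
    simp only [Matrix.sum_mulVec, Matrix.smul_mulVec, dotProduct_sum, dotProduct_smul, smul_eq_mul,
      hP]
  -- Exactly `N ^ (n - r)` colorings match `s` on `T`; multiplying by `N ^ r` avoids the
  -- subtraction.
  have hcol : ∀ s T, (N : ℂ) ^ n * P s T =
      N ^ r * ∑ χ : Fin n → S, if ∀ i, χ (T i) = s i then P s T else 0 := by
    intro s T
    have := card_colorings_mul T s
    rw [← Finset.sum_filter, Finset.sum_const, nsmul_eq_mul, ← mul_assoc]
    congr 1
    rw [hN]
    push_cast
    rw [mul_comm]
    exact_mod_cast this.symm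
  -- For fixed `χ`, the unitary `⨂ U (χ i)` diagonalizes all matching terms at once, and it
  -- preserves the norm of `ψ`.
  have hχ : ∀ (s : Fin r → S) (χ : Fin n → S),
      ‖∑ T ∈ H, (x T : ℂ) * if ∀ i, χ (T i) = s i then P s T else 0‖ ≤
        δ * ∑ b, ‖ψ b‖ ^ 2 := by
    intro s χ
    set φ := (qubitTensor fun i => U (χ i))ᴴ *ᵥ ψ with hφ
    have h1 : ∀ T : Fin r ↪ Fin n, (if ∀ i, χ (T i) = s i then P s T else 0) =
        ((∑ b, ‖φ b‖ ^ 2 * (if ∀ i, χ (T i) = s i then ∏ i, d (χ (T i)) (b (T i)) else 0) : ℝ) :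
          ℂ) := by
      intro T
      split_ifs with h
      · rw [hφ, ← star_dotProduct_localOperator_qubitTensor (fun i => U (χ i)) (fun i => d (χ i))
          (fun i => hU _) T ψ]
        simp only [hP, h]
      · simp
    have h2 : ∑ T ∈ H, (x T : ℂ) * (if ∀ i, χ (T i) = s i then P s T else 0) =
        ((∑ b, ‖φ b‖ ^ 2 * ∑ T ∈ H, x T *
          (if ∀ i, χ (T i) = s i then ∏ i, d (χ (T i)) (b (T i)) else 0) : ℝ) : ℂ) := by
      simp only [h1, ← Complex.ofReal_mul, ← Complex.ofReal_sum]
      congr 1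
      simp only [Finset.mul_sum]
      rw [Finset.sum_comm]
      exact Finset.sum_congr rfl fun b _ => Finset.sum_congr rfl fun T _ => by ring
    rw [h2, Complex.norm_real, Real.norm_eq_abs]
    calc _ ≤ ∑ b, |‖φ b‖ ^ 2 * ∑ T ∈ H, x T *
          (if ∀ i, χ (T i) = s i then ∏ i, d (χ (T i)) (b (T i)) else 0)| :=
          Finset.abs_sum_le_sum_abs _ _
      _ ≤ ∑ b, ‖φ b‖ ^ 2 * δ := by
          refine Finset.sum_le_sum fun b _ => ?_
          rw [abs_mul, abs_of_nonneg (by positivity)]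
          exact mul_le_mul_of_nonneg_left (hx (χ, s, b)) (by positivity)
      _ = δ * ∑ b, ‖ψ b‖ ^ 2 := by
          rw [← Finset.sum_mul, hφ, sum_norm_sq_qubitTensor _ (fun i => hU _), mul_comm]
  have hs : ∀ s, ‖∑ T ∈ H, (x T : ℂ) * P s T‖ ≤ N ^ r * (δ * ∑ b, ‖ψ b‖ ^ 2) := by
    intro s
    have h1 : (N : ℂ) ^ n * ∑ T ∈ H, (x T : ℂ) * P s T = N ^ r * ∑ χ : Fin n → S,
        ∑ T ∈ H, (x T : ℂ) * if ∀ i, χ (T i) = s i then P s T else 0 := by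
      rw [Finset.sum_comm, Finset.mul_sum, Finset.mul_sum]
      refine Finset.sum_congr rfl fun T _ => ?_
      rw [mul_left_comm, hcol, ← Finset.mul_sum]
      ring
    have h2 : ‖(N : ℂ) ^ n * ∑ T ∈ H, (x T : ℂ) * P s T‖ ≤
        N ^ r * (N ^ n * (δ * ∑ b, ‖ψ b‖ ^ 2)) := by
      rw [h1, norm_mul, norm_pow, Complex.norm_real, Real.norm_of_nonneg hNpos.le]
      refine mul_le_mul_of_nonneg_left ((norm_sum_le _ _).trans
        ((Finset.sum_le_sum fun χ _ => hχ s χ).trans (le_of_eq ?_))) hNr.le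
      rw [Finset.sum_const, Finset.card_univ, Fintype.card_fun, Fintype.card_fin, nsmul_eq_mul]
      push_cast
      rfl
    rw [norm_mul, norm_pow, Complex.norm_real, Real.norm_of_nonneg hNpos.le, mul_left_comm] at h2
    exact le_of_mul_le_mul_left h2 (by positivity)
  have hre : ∑ T ∈ H, x T * termEnergy M T ψ =
      (∑ s, m s * ∑ T ∈ H, (x T : ℂ) * P s T).re := by
    simp only [hterm, ← Complex.re_ofReal_mul, ← Complex.re_sum]
    congr 1
    simp only [Finset.mul_sum]
    rw [Finset.sum_comm]
    exact Finset.sum_congr rfl fun s _ => Finset.sum_congr rfl fun T _ => by ring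
  rw [hre]
  calc _ ≤ ‖∑ s, m s * ∑ T ∈ H, (x T : ℂ) * P s T‖ := Complex.abs_re_le_norm _
    _ ≤ ∑ s, ‖m s * ∑ T ∈ H, (x T : ℂ) * P s T‖ := norm_sum_le _ _
    _ ≤ ∑ s, ‖m s‖ * (N ^ r * (δ * ∑ b, ‖ψ b‖ ^ 2)) := by
        refine Finset.sum_le_sum fun s _ => ?_
        rw [norm_mul]
        exact mul_le_mul_of_nonneg_left (hs s) (norm_nonneg _)
    _ = (N ^ r * ∑ s, ‖m s‖) * (δ * ∑ b, ‖ψ b‖ ^ 2) := by rw [← Finset.sum_mul]; ring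
    _ ≤ K * (δ * ∑ b, ‖ψ b‖ ^ 2) := by gcongr
    _ = K * δ * ∑ b, ‖ψ b‖ ^ 2 := by ring

/-! ### Positivity and the lower bound on the energy. -/

theorem localOperator_mul {r n : ℕ} (A B : Matrix (BitString r) (BitString r) ℂ)
    (T : Fin r ↪ Fin n) :
    localOperator (A * B) T = localOperator A T * localOperator B T := by
  classical
  ext x z
  simp only [localOperator, Matrix.mul_apply, Matrix.of_apply]
  have hsupp : ∀ y : BitString n, (∀ i, (∀ j, T j ≠ i) → x i = y i) →
      ((∀ i, (∀ j, T j ≠ i) → y i = z i) ↔ ∀ i, (∀ j, T j ≠ i) → x i = z i) := by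
    intro y hy
    exact forall₂_congr fun i hi => by rw [hy i hi]
  -- A string agreeing with `x` off `T` is determined by its restriction to `T`, which can be
  -- arbitrary.
  have hsum : ∀ f : BitString r → ℂ, ∑ a, f a =
      ∑ y : BitString n with ∀ i, (∀ j, T j ≠ i) → x i = y i, f fun j => y (T j) := by
    intro f
    refine Finset.sum_bij' (fun a _ => Function.extend T a x) (fun y _ j => y (T j)) ?_ ?_ ?_ ?_ ?_
    · intro a _
      simp only [Finset.mem_filter, Finset.mem_univ, true_and]
      intro i hi
      rw [Function.extend_apply' _ _ _ (by simpa using hi)]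
    · simp
    · intro a _
      funext j
      exact T.injective.extend_apply _ _ _
    · intro y hy
      simp only [Finset.mem_filter, Finset.mem_univ, true_and] at hy
      funext i
      by_cases hi : ∃ j, T j = i
      · obtain ⟨j, rfl⟩ := hi
        exact T.injective.extend_apply _ _ _
      · rw [Function.extend_apply' _ _ _ hi, hy i (by simpa using hi)]
    · intro a _
      congr 1
      funext j
      exact (T.injective.extend_apply _ _ _).symm
  simp only [ite_mul, zero_mul]
  rw [← Finset.sum_filter, hsum]
  split_ifs with h
  · refine Finset.sum_congr rfl fun y hy => ?_
    rw [if_pos ((hsupp y (Finset.mem_filter.1 hy).2).2 h)]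
  · refine (Finset.sum_eq_zero fun y hy => ?_).symm
    rw [if_neg (fun h' => h ((hsupp y (Finset.mem_filter.1 hy).2).1 h')), mul_zero]

theorem conjTranspose_localOperator {r n : ℕ} (A : Matrix (BitString r) (BitString r) ℂ)
    (T : Fin r ↪ Fin n) : (localOperator A T)ᴴ = localOperator Aᴴ T := by
  ext x y
  simp only [localOperator, Matrix.conjTranspose_apply, Matrix.of_apply, apply_ite star, star_zero]
  simp only [eq_comm]

theorem localOperator_one {r n : ℕ} (T : Fin r ↪ Fin n) :
    localOperator (1 : Matrix (BitString r) (BitString r) ℂ) T = 1 := by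
  have h := localOperator_qubitTensor (fun _ => 1) T
  simpa [qubitTensor_one] using h

-- Localization respects products and adjoints, so a factorization `M = Bᴴ B` passes to `M_T`.
open scoped MatrixOrder in
theorem termEnergy_nonneg {r n : ℕ} {M : Matrix (BitString r) (BitString r) ℂ} (hM : M.PosSemidef)
    (T : Fin r ↪ Fin n) (ψ : BitString n → ℂ) : 0 ≤ termEnergy M T ψ := by
  obtain ⟨B, rfl⟩ := CStarAlgebra.nonneg_iff_eq_star_mul_self.1 hM.nonneg
  rw [termEnergy, Matrix.star_eq_conjTranspose, localOperator_mul, ← conjTranspose_localOperator]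
  exact (Complex.le_def.1
    ((Matrix.posSemidef_conjTranspose_mul_self (localOperator B T)).dotProduct_mulVec_nonneg ψ)).1

/-- Full rank excludes the eigenvalue zero, so the least eigenvalue serves as `l`. -/
theorem exists_sub_smul_one_posSemidef {ι : Type*} [Fintype ι] [DecidableEq ι]
    {M : Matrix ι ι ℂ} (hM : M.PosSemidef) (hrank : M.rank = Fintype.card ι) :
    ∃ l : ℝ, 0 < l ∧ (M - (l : ℂ) • (1 : Matrix ι ι ℂ)).PosSemidef := by
  have hev : ∀ i, 0 < hM.1.eigenvalues i := by
    intro i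
    refine lt_of_le_of_ne (hM.eigenvalues_nonneg i) fun h0 => ?_
    rw [hM.1.rank_eq_card_non_zero_eigs] at hrank
    exact absurd hrank (Fintype.card_subtype_lt (x := i) (by simp [← h0])).ne
  obtain ⟨l, hl, hle⟩ : ∃ l : ℝ, 0 < l ∧ ∀ i, l ≤ hM.1.eigenvalues i := by
    rcases isEmpty_or_nonempty ι with h | h
    · exact ⟨1, one_pos, fun i => isEmptyElim i⟩
    · obtain ⟨i, hi⟩ := Finite.exists_min hM.1.eigenvalues
      exact ⟨_, hev i, hi⟩
  refine ⟨l, hl, ?_⟩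
  set V : Matrix ι ι ℂ := (hM.1.eigenvectorUnitary : Matrix ι ι ℂ) with hV
  have hVV : V * Vᴴ = 1 := Unitary.coe_mul_star_self _
  have hspec : M = V * Matrix.diagonal (fun i => (hM.1.eigenvalues i : ℂ)) * Vᴴ := by
    conv_lhs => rw [hM.1.spectral_theorem, Unitary.conjStarAlgAut_apply]
    rfl
  have : M - (l : ℂ) • (1 : Matrix ι ι ℂ) =
      V * Matrix.diagonal (fun i => ((hM.1.eigenvalues i - l : ℝ) : ℂ)) * Vᴴ := by
    have hd : Matrix.diagonal (fun i => ((hM.1.eigenvalues i - l : ℝ) : ℂ)) =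
        Matrix.diagonal (fun i => (hM.1.eigenvalues i : ℂ)) - (l : ℂ) • (1 : Matrix ι ι ℂ) := by
      rw [Matrix.smul_one_eq_diagonal, Matrix.diagonal_sub]
      congr 1; funext i; push_cast; rfl
    rw [hd, Matrix.mul_sub, Matrix.sub_mul, ← hspec, Matrix.mul_smul, Matrix.mul_one,
      Matrix.smul_mul, hVV]
  rw [this]
  refine Matrix.PosSemidef.mul_mul_conjTranspose_same (Matrix.PosSemidef.diagonal fun i => ?_) V
  have := hle i
  simp only [Pi.zero_apply]
  exact_mod_cast sub_nonneg.2 this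

theorem exists_le_termEnergy {r : ℕ} {M : Matrix (BitString r) (BitString r) ℂ}
    (hM : M.PosSemidef) (hrank : M.rank = 2 ^ r) :
    ∃ l : ℝ, 0 < l ∧ ∀ (n : ℕ) (T : Fin r ↪ Fin n) (ψ : BitString n → ℂ),
      l * ∑ b, ‖ψ b‖ ^ 2 ≤ termEnergy M T ψ := by
  obtain ⟨l, hl, hpsd⟩ := exists_sub_smul_one_posSemidef hM (by simpa using hrank)
  refine ⟨l, hl, fun n T ψ => ?_⟩
  have h := termEnergy_nonneg hpsd T ψ
  have hsub : localOperator (M - (l : ℂ) • (1 : Matrix (BitString r) (BitString r) ℂ)) T =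
      localOperator M T - (l : ℂ) • (1 : Matrix (BitString n) (BitString n) ℂ) := by
    rw [← localOperator_one T]
    ext x y
    simp only [localOperator, Matrix.of_apply, Matrix.sub_apply, Matrix.smul_apply]
    split_ifs <;> simp
  rw [termEnergy, hsub, Matrix.sub_mulVec, dotProduct_sub, Complex.sub_re, Matrix.smul_mulVec,
    Matrix.one_mulVec, dotProduct_smul, star_dotProduct_self_eq_sum, smul_eq_mul,
    ← Complex.ofReal_mul, Complex.ofReal_re] at h
  rw [termEnergy]
  linarith

/-! ### Chernoff bounds for random subsets. -/

open MeasureTheory ProbabilityTheory in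
/-- Markov's inequality for a random subset of a finite set. -/
theorem setBernoulli_real_le_sum {ι : Type*} [Finite ι] [DecidableEq ι] (H : Finset ι)
    (p : unitInterval) (E : Set (Set ι)) (F : Finset ι → ℝ) (hF : ∀ A, 0 ≤ F A)
    (hE : ∀ A ⊆ H, (A : Set ι) ∈ E → 1 ≤ F A) :
    (setBernoulli (H : Set ι) p).real E ≤
      ∑ A ∈ H.powerset, F A * ((p : ℝ) ^ A.card * (1 - p : ℝ) ^ (H \ A).card) := by
  classical
  have hsub : (setBernoulli (H : Set ι) p).real E =
      (setBernoulli (H : Set ι) p).real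
        (⋃ A ∈ H.powerset.filter (fun A : Finset ι => (A : Set ι) ∈ E), {(A : Set ι)}) := by
    rw [measureReal_def, setBernoulli_apply_eq_apply_subsets, ← measureReal_def]
    congr 1
    ext s
    simp only [Set.mem_iUnion, Finset.mem_filter, Finset.mem_powerset, Set.mem_singleton_iff,
      exists_prop]
    constructor
    · rintro ⟨h1, h2⟩
      lift s to Finset ι using H.finite_toSet.subset h2
      exact ⟨s, ⟨by exact_mod_cast h2, h1⟩, rfl⟩
    · rintro ⟨A, ⟨h1, h2⟩, rfl⟩
      exact ⟨h2, by exact_mod_cast h1⟩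
  have hp0 : (0 : ℝ) ≤ p := p.2.1
  have hp1 : (0 : ℝ) ≤ 1 - p := sub_nonneg.2 p.2.2
  rw [hsub]
  refine (measureReal_biUnion_finset_le _ _).trans ?_
  calc _ = ∑ A ∈ H.powerset.filter (fun A : Finset ι => (A : Set ι) ∈ E),
        ((p : ℝ) ^ A.card * (1 - p : ℝ) ^ (H \ A).card) := by
        refine Finset.sum_congr rfl fun A hA => ?_
        have hAH := Finset.mem_powerset.1 (Finset.mem_filter.1 hA).1
        rw [setBernoulli_real_singleton p (by exact_mod_cast hAH) H.finite_toSet,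
          ← Finset.coe_sdiff, Set.ncard_coe_finset, Set.ncard_coe_finset]
    _ ≤ ∑ A ∈ H.powerset.filter (fun A : Finset ι => (A : Set ι) ∈ E),
        F A * ((p : ℝ) ^ A.card * (1 - p : ℝ) ^ (H \ A).card) := by
        refine Finset.sum_le_sum fun A hA => ?_
        obtain ⟨h1, h2⟩ := Finset.mem_filter.1 hA
        exact le_mul_of_one_le_left (by positivity) (hE A (Finset.mem_powerset.1 h1) h2)
    _ ≤ _ := Finset.sum_le_sum_of_subset_of_nonneg (Finset.filter_subset _ _)
        fun A _ _ => mul_nonneg (hF A) (by positivity)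

/-- The moment generating function factors by independence, here the expansion of a product of
binomials. -/
theorem sum_powerset_exp_mul {ι : Type*} [DecidableEq ι] (H : Finset ι) (p : ℝ) (f : ι → ℝ) :
    ∑ A ∈ H.powerset, Real.exp (∑ T ∈ A, f T) * (p ^ A.card * (1 - p) ^ (H \ A).card) =
      ∏ T ∈ H, (1 + p * (Real.exp (f T) - 1)) := by
  have : ∀ T, 1 + p * (Real.exp (f T) - 1) = p * Real.exp (f T) + (1 - p) := fun T => by ring
  simp only [this, Finset.prod_add]
  refine Finset.sum_congr rfl fun A _ => ?_
  rw [Finset.prod_mul_distrib, Finset.prod_const, Finset.prod_const, Real.exp_sum]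
  ring

open Classical MeasureTheory ProbabilityTheory in
/-- One-sided Chernoff bound for weighted sums over a random subset. -/
theorem setBernoulli_real_sum_gt_le {ι : Type*} [Finite ι] (H : Finset ι) (p : unitInterval)
    (g : ι → ℝ) (B δ : ℝ) (hB : 0 < B) (hg : ∀ T, |g T| ≤ B) (hδ : 0 ≤ δ) (hδB : δ ≤ 2 * B) :
    (setBernoulli (H : Set ι) p).real
      {G | δ * (p * H.card) < ∑ T ∈ H, ((if T ∈ G then 1 else 0) - (p : ℝ)) * g T} ≤
        Real.exp (-(p * H.card * δ ^ 2 / (4 * B ^ 2))) := by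
  -- Minimizes the exponent `p |H| (t² B² - t δ)`; `δ ≤ 2 B` keeps `t B ≤ 1`, where `exp u ≤ 1 + u +
  -- u²` is available.
  set t : ℝ := δ / (2 * B ^ 2) with ht
  have ht0 : 0 ≤ t := by positivity
  have htB : t * B ≤ 1 := by
    rw [ht, div_mul_eq_mul_div, div_le_one (by positivity)]
    nlinarith
  have hp0 : (0 : ℝ) ≤ p := p.2.1
  set c : ℝ := ∑ T ∈ H, p * (t * g T) + t * (δ * (p * H.card)) with hc
  refine (setBernoulli_real_le_sum H p _
    (fun A => Real.exp (-c) * Real.exp (∑ T ∈ A, t * g T))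
    (fun A => by positivity) ?_).trans ?_
  · intro A hA hmem
    replace hmem : δ * (p * H.card) < ∑ T ∈ A, g T - ∑ T ∈ H, p * g T := by
      rw [Set.mem_ofPred_eq] at hmem
      convert hmem using 1
      simp only [sub_mul, Finset.sum_sub_distrib, Finset.mem_coe, ite_mul, one_mul, zero_mul]
      rw [← Finset.sum_filter, Finset.filter_mem_eq_inter, Finset.inter_eq_right.2 hA]
    rw [← Real.exp_add]
    apply Real.one_le_exp
    have h2 : ∑ T ∈ H, p * (t * g T) = t * ∑ T ∈ H, p * g T := by
      rw [Finset.mul_sum]; exact Finset.sum_congr rfl fun _ _ => by ring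
    rw [hc, h2, ← Finset.mul_sum A]
    nlinarith [mul_le_mul_of_nonneg_left hmem.le ht0]
  · simp only [mul_assoc (Real.exp (-c))]
    rw [← Finset.mul_sum, sum_powerset_exp_mul]
    have hfac : ∀ T ∈ H, 1 + (p : ℝ) * (Real.exp (t * g T) - 1) ≤
        Real.exp (p * (t * g T) + p * (t * B) ^ 2) := by
      intro T _
      have habs : |t * g T| ≤ t * B := by
        rw [abs_mul, abs_of_nonneg ht0]; exact mul_le_mul_of_nonneg_left (hg T) ht0
      have h1 := (abs_le.1 (Real.abs_exp_sub_one_sub_id_le (habs.trans htB))).2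
      have h2 : (t * g T) ^ 2 ≤ (t * B) ^ 2 := sq_le_sq' (abs_le.1 habs).1 (abs_le.1 habs).2
      have h3 : (p : ℝ) * (Real.exp (t * g T) - 1) ≤ p * (t * g T + (t * B) ^ 2) :=
        mul_le_mul_of_nonneg_left (by linarith) hp0
      have h4 := Real.add_one_le_exp (p * (t * g T) + p * (t * B) ^ 2)
      linarith
    have hprod : ∏ T ∈ H, (1 + (p : ℝ) * (Real.exp (t * g T) - 1)) ≤
        Real.exp (∑ T ∈ H, (p * (t * g T) + p * (t * B) ^ 2)) := by
      rw [Real.exp_sum]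
      refine Finset.prod_le_prod (fun T _ => ?_) hfac
      have := mul_nonneg hp0 (Real.exp_pos (t * g T)).le
      have := p.2.2
      nlinarith
    refine (mul_le_mul_of_nonneg_left hprod (Real.exp_pos _).le).trans ?_
    rw [← Real.exp_add]
    apply Real.exp_le_exp.2
    rw [Finset.sum_add_distrib, Finset.sum_const, nsmul_eq_mul, hc, ht]
    apply le_of_eq
    field_simp
    ring

open Classical MeasureTheory ProbabilityTheory in
/-- Two-sided Chernoff bound for weighted sums over a random subset. -/
theorem setBernoulli_real_abs_sum_gt_le {ι : Type*} [Finite ι] (H : Finset ι) (p : unitInterval)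
    (g : ι → ℝ) (B δ : ℝ) (hB : 0 < B) (hg : ∀ T, |g T| ≤ B) (hδ : 0 ≤ δ) (hδB : δ ≤ 2 * B) :
    (setBernoulli (H : Set ι) p).real
      {G | δ * (p * H.card) < |∑ T ∈ H, ((if T ∈ G then 1 else 0) - (p : ℝ)) * g T|} ≤
        2 * Real.exp (-(p * H.card * δ ^ 2 / (4 * B ^ 2))) := by
  have h1 := setBernoulli_real_sum_gt_le H p g B δ hB hg hδ hδB
  have h2 := setBernoulli_real_sum_gt_le H p (fun T => -g T) B δ hB (by simpa using hg) hδ hδB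
  rw [two_mul]
  refine le_trans (measureReal_mono ?_ ) ((measureReal_union_le _ _).trans (add_le_add h1 h2))
  intro G hG
  rw [Set.mem_ofPred_eq, lt_abs] at hG
  rcases hG with hG | hG
  · exact Or.inl hG
  · right
    simpa only [Set.mem_ofPred_eq, mul_neg, Finset.sum_neg_distrib] using hG

open Classical MeasureTheory ProbabilityTheory in
/-- Union bound: a random subset is simultaneously typical for finitely many weightings. -/
theorem setBernoulli_real_exists_abs_sum_gt_le {ι J : Type*} [Finite ι] [Fintype J] (H : Finset ι)
    (p : unitInterval) (g : J → ι → ℝ) (B δ : ℝ) (hB : 0 < B) (hg : ∀ j T, |g j T| ≤ B)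
    (hδ : 0 ≤ δ) (hδB : δ ≤ 2 * B) :
    (setBernoulli (H : Set ι) p).real
      {G | ∃ j, δ * (p * H.card) < |∑ T ∈ H, ((if T ∈ G then 1 else 0) - (p : ℝ)) * g j T|} ≤
        Fintype.card J * (2 * Real.exp (-(p * H.card * δ ^ 2 / (4 * B ^ 2)))) := by
  rw [Set.ofPred_exists]
  refine (measureReal_iUnion_fintype_le _).trans ?_
  refine (Finset.sum_le_sum fun j _ =>
    setBernoulli_real_abs_sum_gt_le H p (g j) B δ hB (hg j) hδ hδB).trans (le_of_eq ?_)
  rw [Finset.sum_const, Finset.card_univ, nsmul_eq_mul]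

/-! ### From typical samples to sparsifiers. -/

theorem energy_eq_sum {r n : ℕ} (M : Matrix (BitString r) (BitString r) ℂ)
    (H : PredicateHamiltonian r n) (ψ : BitString n → ℂ) :
    energy M H ψ = ∑ T ∈ H, termEnergy M T ψ :=
  Finset.sum_coe_sort H fun T => termEnergy M T ψ

open Classical in
theorem weightedEnergy_sampledWeight {r n : ℕ} (M : Matrix (BitString r) (BitString r) ℂ)
    (H : PredicateHamiltonian r n) (p : unitInterval) (G : Set (Fin r ↪ Fin n))
    (ψ : BitString n → ℂ) :
    weightedEnergy M H (sampledWeight H p G) ψ =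
      ∑ T ∈ H, (if T ∈ G then 1 / (p : ℝ) else 0) * termEnergy M T ψ := by
  rw [weightedEnergy, ← Finset.sum_coe_sort H
    fun T => (if T ∈ G then 1 / (p : ℝ) else 0) * termEnergy M T ψ]
  refine Finset.sum_congr rfl fun T _ => ?_
  congr 1
  simp only [sampledWeight]
  split_ifs <;> simp

open Classical in
theorem sparsifierSize_sampledWeight_le {r n : ℕ} (H : PredicateHamiltonian r n)
    (p : unitInterval) (G : Set (Fin r ↪ Fin n)) :
    sparsifierSize (sampledWeight H p G) ≤ (H.filter (· ∈ G)).card := by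
  rw [sparsifierSize, ← Set.ncard_coe_finset]
  refine Set.ncard_le_ncard_of_injOn Subtype.val (fun T hT => ?_) Subtype.val_injective.injOn
    (Finset.finite_toSet _)
  rw [Function.mem_support, sampledWeight, ne_eq, ite_eq_right_iff, Classical.not_imp] at hT
  exact Finset.mem_coe.2 (Finset.mem_filter.2 ⟨T.2, hT.1⟩)

theorem sparsifierSize_le_card {r n : ℕ} {H : PredicateHamiltonian r n} (w : H → ℝ≥0) :
    sparsifierSize w ≤ H.card := by
  refine (Set.ncard_le_card _).trans (le_of_eq ?_)
  simp

theorem isSparsifier_of_abs_sub_le {r n : ℕ} {M : Matrix (BitString r) (BitString r) ℂ}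
    {H : PredicateHamiltonian r n} {ε : ℝ} {w : H → ℝ≥0}
    (h : ∀ ψ, |weightedEnergy M H w ψ - energy M H ψ| ≤ ε * energy M H ψ) :
    IsSparsifier M H ε w := fun ψ => by
  obtain ⟨h1, h2⟩ := abs_le.1 (h ψ)
  constructor <;> linarith

/-- The cost of the union bound: `+ 1` is for the form measuring sample size, and `4` is two tails
times a further factor two that halves the failure probability. The exponent is linear in `k * n`,
whence the condition `c ≥ c₀ k`. -/
theorem four_mul_pow_add_one_mul_pow_le_exp (q Q n k : ℕ) (hn : 1 ≤ n) (hk : 1 ≤ k) :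
    4 * ((q : ℝ) * Q ^ n + 1) * n ^ k ≤
      Real.exp ((Real.log (4 * (q + 1) * (Q + 1)) + 1) * k * n) := by
  have hX : (1 : ℝ) ≤ 4 * (q + 1) * (Q + 1) := by
    have hq : (0 : ℝ) ≤ q := q.cast_nonneg
    have hQ : (0 : ℝ) ≤ Q := Q.cast_nonneg
    nlinarith [mul_nonneg hq hQ]
  have hL := Real.log_nonneg hX
  have hk' : (1 : ℝ) ≤ k := by exact_mod_cast hk
  have h1 : 4 * ((q : ℝ) * Q ^ n + 1) ≤ (4 * (q + 1) * (Q + 1)) ^ n := by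
    have hQn : (Q : ℝ) ^ n ≤ (Q + 1) ^ n := by gcongr; linarith
    have hQ1 : (1 : ℝ) ≤ (Q + 1) ^ n := one_le_pow₀ (by simp)
    have hqn : (4 * (q + 1) : ℝ) ≤ (4 * (q + 1)) ^ n :=
      le_self_pow₀ (by have : (0 : ℝ) ≤ q := q.cast_nonneg
                       linarith) (by omega)
    calc 4 * ((q : ℝ) * Q ^ n + 1) ≤ 4 * (q * (Q + 1) ^ n + (Q + 1) ^ n) := by gcongr
      _ = (4 * (q + 1)) * (Q + 1) ^ n := by ring
      _ ≤ (4 * (q + 1)) ^ n * (Q + 1) ^ n := by gcongr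
      _ = _ := (mul_pow _ _ _).symm
  have h2 : (n : ℝ) ^ k ≤ Real.exp (k * n) := by
    rw [Real.exp_nat_mul]
    gcongr
    linarith [Real.add_one_le_exp (n : ℝ)]
  have h3 : (4 * (q + 1) * (Q + 1) : ℝ) ^ n = Real.exp (Real.log (4 * (q + 1) * (Q + 1)) * n) := by
    rw [mul_comm (Real.log _), Real.exp_nat_mul, Real.exp_log (by linarith)]
  calc _ ≤ Real.exp (Real.log (4 * (q + 1) * (Q + 1)) * n) * Real.exp (k * n) := by
        rw [← h3]; gcongr
    _ = Real.exp (Real.log (4 * (q + 1) * (Q + 1)) * n + k * n) := (Real.exp_add _ _).symm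
    _ ≤ _ := by
        apply Real.exp_le_exp.2
        have := mul_le_mul_of_nonneg_left hk' (mul_nonneg hL n.cast_nonneg)
        linarith

/-- A sample typical for all scalar linear forms is a sparsifier of the expected size. -/
theorem exists_sampling_bound (r : ℕ) (M : Matrix (BitString r) (BitString r) ℂ)
    (hM : M.PosSemidef) (hrank : M.rank = 2 ^ r) :
    ∃ c₀ C : ℝ, 0 < c₀ ∧ 0 < C ∧
      ∀ k : ℕ, 1 ≤ k → ∀ c : ℝ, c₀ * k ≤ c →
        ∀ n : ℕ, 1 ≤ n → ∀ (H : PredicateHamiltonian r n) (ε : ℝ), 0 < ε → ε < 1 →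
          ∀ p : unitInterval, (p : ℝ) = min 1 (c * n / (ε ^ 2 * H.card)) →
            1 - 1 / 2 * (1 / (n : ℝ) ^ k) ≤
              (ProbabilityTheory.setBernoulli (H : Set (Fin r ↪ Fin n)) p).real
                {G | IsSparsifier M H ε (sampledWeight H p G) ∧
                  (sparsifierSize (sampledWeight H p G) : ℝ) ≤ C * c * (n / ε ^ 2)} := by
  classical
  obtain ⟨K, q, Q, hK, hscalar⟩ := exists_scalar_energy_bound r M
  obtain ⟨l, hl, hlow⟩ := exists_le_termEnergy hM hrank
  -- Dominates the scalar forms (`K`), the constant form (`1`), and the deviation `δ ≤ l / K`, as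
  -- the Chernoff bound requires.
  set B : ℝ := K + l / K + 1 with hB
  have hlK : 0 < l / K := by positivity
  have hB0 : 0 < B := by positivity
  set κ : ℝ := l ^ 2 / (4 * K ^ 2 * B ^ 2) with hκ
  have hκ0 : 0 < κ := by positivity
  set L : ℝ := Real.log (4 * (q + 1) * (Q + 1)) with hL
  have hL0 : 0 ≤ L := by
    apply Real.log_nonneg
    have hq : (0 : ℝ) ≤ q := q.cast_nonneg
    have hQ : (0 : ℝ) ≤ Q := Q.cast_nonneg
    nlinarith [mul_nonneg hq hQ]
  have hc₀ : 0 < (L + 1) / κ := by positivity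
  refine ⟨(L + 1) / κ, 1 + l / K, hc₀, by positivity, ?_⟩
  intro k hk c hc n hn H ε hε hε1 p hp
  have hn0 : (0 : ℝ) < n := by exact_mod_cast hn
  have hk0 : (0 : ℝ) < k := by exact_mod_cast hk
  have hc0 : 0 < c := lt_of_lt_of_le (mul_pos hc₀ hk0) hc
  set μ := ProbabilityTheory.setBernoulli (H : Set (Fin r ↪ Fin n)) p with hμ
  set E : Set (Set (Fin r ↪ Fin n)) := {G | IsSparsifier M H ε (sampledWeight H p G) ∧
    (sparsifierSize (sampledWeight H p G) : ℝ) ≤ (1 + l / K) * c * (n / ε ^ 2)} with hE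
  have hsize0 : 0 ≤ (1 + l / K) * c * (n / ε ^ 2) := by positivity
  have hfail : 0 ≤ 1 / 2 * (1 / (n : ℝ) ^ k) := by positivity
  have hE0 : ∀ ψ, 0 ≤ energy M H ψ := fun ψ => by
    rw [energy_eq_sum]; exact Finset.sum_nonneg fun T _ => termEnergy_nonneg hM T ψ
  rcases H.eq_empty_or_nonempty with hH | hH
  · have : E = Set.univ := by
      refine Set.eq_univ_of_forall fun G => ⟨?_, ?_⟩
      · refine isSparsifier_of_abs_sub_le fun ψ => ?_
        rw [weightedEnergy_sampledWeight, energy_eq_sum, hH]; simp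
      · refine le_trans ?_ hsize0
        have := sparsifierSize_le_card (sampledWeight H p G)
        rw [Finset.card_eq_zero.2 hH] at this
        exact_mod_cast this
    rw [this, MeasureTheory.probReal_univ]
    linarith
  have hHc : (0 : ℝ) < H.card := by exact_mod_cast hH.card_pos
  -- If the minimum is `1`, the sample is all of `H` almost surely, and `H` already has at most `c n
  -- / ε²` terms.
  rcases le_total 1 (c * n / (ε ^ 2 * H.card)) with hbig | hsmall
  · rw [min_eq_left hbig] at hp
    have hp1 : p = 1 := Subtype.ext hp
    have hmem : (H : Set (Fin r ↪ Fin n)) ∈ E := by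
      refine ⟨isSparsifier_of_abs_sub_le fun ψ => ?_, ?_⟩
      · have hw : weightedEnergy M H (sampledWeight H p H) ψ = energy M H ψ := by
          rw [weightedEnergy_sampledWeight, energy_eq_sum, hp]
          refine Finset.sum_congr rfl fun T hT => ?_
          simp [hT]
        rw [hw, sub_self, abs_zero]
        exact mul_nonneg hε.le (hE0 ψ)
      · have h1 : (sparsifierSize (sampledWeight H p H) : ℝ) ≤ H.card := by
          exact_mod_cast sparsifierSize_le_card _
        have h2 : (H.card : ℝ) ≤ c * (n / ε ^ 2) := by
          rw [le_div_iff₀ (by positivity)] at hbig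
          rw [← mul_div_assoc, le_div_iff₀ (by positivity)]
          linarith
        have h3 : 0 ≤ l / K * (c * (n / ε ^ 2)) := by positivity
        linarith
    have : μ.real E = 1 := by
      rw [hμ, hp1, ProbabilityTheory.setBernoulli_one, MeasureTheory.measureReal_def,
        MeasureTheory.Measure.dirac_apply_of_mem hmem]
      simp
    rw [this]
    linarith
  rw [min_eq_right hsmall] at hp
  have hpH : (p : ℝ) * H.card = c * (n / ε ^ 2) := by rw [hp]; field_simp
  have hp0 : (0 : ℝ) < p := by rw [hp]; positivity
  obtain ⟨J, _, g, hJ, hgK, hg⟩ := hscalar n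
  -- Chosen so that the error `K δ |H| ‖ψ‖²` equals `ε l |H| ‖ψ‖²`.
  set δ : ℝ := ε * l / K with hδ
  have hδ0 : 0 ≤ δ := by positivity
  have hδl : δ ≤ l / K := by
    rw [hδ]; gcongr; nlinarith
  -- The extra constant form `none` controls the number of sampled terms, hence the size.
  set g' : Option J → (Fin r ↪ Fin n) → ℝ := fun j T => j.elim 1 fun j => g j T with hg'
  have hg'B : ∀ j T, |g' j T| ≤ B := by
    rintro (_ | j) T
    · simp only [hg', Option.elim_none, abs_one]; linarith
    · exact (hgK j T).trans (by linarith)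
  have hbad := setBernoulli_real_exists_abs_sum_gt_le H p g' B δ hB0 hg'B hδ0 (by linarith)
  set bad : Set (Set (Fin r ↪ Fin n)) := {G | ∃ j, δ * (p * H.card) <
    |∑ T ∈ H, ((if T ∈ G then 1 else 0) - (p : ℝ)) * g' j T|} with hbaddef
  have hcover : Eᶜ ⊆ bad := by
    intro G hG
    by_contra hGb
    rw [hbaddef, Set.mem_ofPred_eq] at hGb
    push Not at hGb
    refine hG ⟨isSparsifier_of_abs_sub_le fun ψ => ?_, ?_⟩
    · have hform : ∀ f : (Fin r ↪ Fin n) → ℝ,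
          ∑ T ∈ H, ((if T ∈ G then 1 / (p : ℝ) else 0) - 1) * f T =
            (∑ T ∈ H, ((if T ∈ G then 1 else 0) - (p : ℝ)) * f T) / p := by
        intro f
        rw [Finset.sum_div]
        refine Finset.sum_congr rfl fun T _ => ?_
        split_ifs <;> field_simp
        ring
      have h1 := hg H (fun T => (if T ∈ G then 1 / (p : ℝ) else 0) - 1) (δ * H.card)
        (by positivity) (fun j => by
          rw [hform, abs_div, abs_of_pos hp0, div_le_iff₀ hp0]
          exact (hGb (some j)).trans (le_of_eq (by ring))) ψ
      have h2 : ∑ T ∈ H, ((if T ∈ G then 1 / (p : ℝ) else 0) - 1) * termEnergy M T ψ =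
          weightedEnergy M H (sampledWeight H p G) ψ - energy M H ψ := by
        rw [weightedEnergy_sampledWeight, energy_eq_sum, ← Finset.sum_sub_distrib]
        exact Finset.sum_congr rfl fun T _ => by ring
      have h3 : H.card * (l * ∑ b, ‖ψ b‖ ^ 2) ≤ energy M H ψ := by
        rw [energy_eq_sum, ← nsmul_eq_mul]
        exact Finset.card_nsmul_le_sum _ _ _ fun T _ => hlow n T ψ
      rw [← h2]
      calc _ ≤ _ := h1
        _ = ε * (H.card * (l * ∑ b, ‖ψ b‖ ^ 2)) := by rw [hδ]; field_simp
        _ ≤ _ := mul_le_mul_of_nonneg_left h3 hε.le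
    · have h1 := (le_abs_self _).trans (hGb none)
      have h2 : ∑ T ∈ H, ((if T ∈ G then 1 else 0) - (p : ℝ)) * g' none T =
          (H.filter (· ∈ G)).card - p * H.card := by
        simp [hg', Finset.sum_sub_distrib, mul_comm]
      have h3 : (sparsifierSize (sampledWeight H p G) : ℝ) ≤ (H.filter (· ∈ G)).card := by
        exact_mod_cast sparsifierSize_sampledWeight_le H p G
      rw [h2, hpH] at h1
      have h4 : δ * (c * (n / ε ^ 2)) ≤ l / K * (c * (n / ε ^ 2)) := by gcongr
      linarith
  have hexp : (p : ℝ) * H.card * δ ^ 2 / (4 * B ^ 2) = κ * c * n := by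
    rw [hpH, hδ, hκ]; field_simp
  have hbad' : μ.real bad ≤ 1 / 2 * (1 / (n : ℝ) ^ k) := by
    refine hbad.trans ?_
    rw [hexp, Fintype.card_option]
    have hJ' : ((Fintype.card J + 1 : ℕ) : ℝ) ≤ q * Q ^ n + 1 := by
      exact_mod_cast Nat.succ_le_succ hJ
    have hmain := four_mul_pow_add_one_mul_pow_le_exp q Q n k hn hk
    have hcκ : (L + 1) * k ≤ κ * c := by
      rw [div_mul_eq_mul_div, div_le_iff₀ hκ0] at hc
      linarith
    have hexp2 : Real.exp ((L + 1) * k * n) ≤ Real.exp (κ * c * n) := by gcongr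
    have hnk : (0 : ℝ) < (n : ℝ) ^ k := by positivity
    calc _ ≤ (q * Q ^ n + 1) * (2 * Real.exp (-(κ * c * n))) := by gcongr
      _ = 1 / 2 * (4 * (q * Q ^ n + 1) * n ^ k * Real.exp (-(κ * c * n))) * (1 / (n : ℝ) ^ k) := by
          field_simp; ring
      _ ≤ 1 / 2 * 1 * (1 / (n : ℝ) ^ k) := by
          gcongr
          rw [Real.exp_neg, ← div_eq_mul_inv, div_le_one (Real.exp_pos _)]
          exact hmain.trans hexp2
      _ = _ := by ring
  -- Subadditivity suffices, so measurability of `E` is not needed.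
  have htot : 1 ≤ μ.real E + μ.real Eᶜ := by
    rw [← MeasureTheory.probReal_univ (μ := μ), ← Set.union_compl_self E]
    exact MeasureTheory.measureReal_union_le _ _
  have hmono : μ.real Eᶜ ≤ μ.real bad := MeasureTheory.measureReal_mono hcover
  linarith

theorem mainTheorem12 (r : ℕ) (M : Matrix (BitString r) (BitString r) ℂ)
    (hM : M.PosSemidef) (hrank : M.rank = 2 ^ r) :
    (∃ C : ℝ, 0 < C ∧
      ∀ n : ℕ, 1 ≤ n → ∀ (H : PredicateHamiltonian r n) (ε : ℝ), 0 < ε → ε < 1 →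
        ∃ w : H → ℝ≥0, IsSparsifier M H ε w ∧ (sparsifierSize w : ℝ) ≤ C * (n / ε ^ 2)) ∧
    (∃ c₀ C : ℝ, 0 < c₀ ∧ 0 < C ∧
      ∀ k : ℕ, 1 ≤ k → ∀ c : ℝ, c₀ * k ≤ c →
        ∀ n : ℕ, 1 ≤ n → ∀ (H : PredicateHamiltonian r n) (ε : ℝ), 0 < ε → ε < 1 →
          ∀ p : unitInterval, (p : ℝ) = min 1 (c * n / (ε ^ 2 * H.card)) →
            1 - 1 / (n : ℝ) ^ k ≤
              (ProbabilityTheory.setBernoulli (H : Set (Fin r ↪ Fin n)) p).real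
                {G | IsSparsifier M H ε (sampledWeight H p G) ∧
                  (sparsifierSize (sampledWeight H p G) : ℝ) ≤ C * c * (n / ε ^ 2)}) := by
  obtain ⟨c₀, C, hc₀, hC, h⟩ := exists_sampling_bound r M hM hrank
  refine ⟨⟨C * c₀, by positivity, fun n hn H ε hε hε1 => ?_⟩, c₀, C, hc₀, hC,
    fun k hk c hc n hn H ε hε hε1 p hp => ?_⟩
  -- The halved failure probability leaves success probability at least `1/2` even for `n = 1`,
  -- where `1 - n⁻ᵏ` vanishes.
  · have h1 := h 1 le_rfl c₀ (by simp) n hn H ε hε hε1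
      ⟨min 1 (c₀ * n / (ε ^ 2 * H.card)), by positivity, min_le_left _ _⟩ rfl
    have hn1 : 1 / (n : ℝ) ^ 1 ≤ 1 := by
      rw [pow_one]
      exact div_le_one_of_le₀ (by exact_mod_cast hn) n.cast_nonneg
    obtain ⟨G, hG⟩ := MeasureTheory.nonempty_of_measureReal_ne_zero
      (lt_of_lt_of_le (by linarith) h1).ne'
    exact ⟨_, hG⟩
  · refine le_trans ?_ (h k hk c hc n hn H ε hε hε1 p hp)
    have : 0 ≤ 1 / (n : ℝ) ^ k := by positivity
    linarith
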